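/- Let $\sigma:\mathbb{R}\to\mathbb{R}$ be either continuous and strictly monotonic (increasing or decreasing) or the ReLU function $t\mapsto\max\{t,0\}$. Let $d_{in}\ge 0$ and $d_{out}\ge 1$ be integers and let $a<b$ be real numbers. A network function with activation function $\sigma$ is a function $F:\mathbb{R}^{d_{in}}\to\mathbb{R}^{d_{out}}$ of the form $$F(x)=W_L\,(A_{L-1}\circ\dots\circ A_1)(x)+b_L,\qquad A_j(x)=\sigma(W_jx+b_j),$$ with depth $L\ge 1$, weights $W_j\in\mathbb{R}^{d_j\times d_{j-1}}$ and biases $b_j\in\mathbb{R}^{d_j}$, where $d_0=d_{in}$, $d_L=d_{out}$ and $\sigma$ is applied elementwise. Its width is $\omega_F=\max\{d_j: j=1,\dots,L\}$. Let $\omega_{\min}(\sigma,d_{in},d_{out})\in\mathbb{N}\cup\{\infty\}$ be the smallest $\omega$ such that for every continuous $f:[a,b]^{d_{in}}\to\mathbb{R}^{d_{out}}$ and every $\varepsilon>0$ there is a network function $F$ with activation function $\sigma$ and of width $\omega_F\le\omega$ such that $\sup_{x\in[a,b]^{d_{in}}}\lVert f(x)-F(x)\rVert<\varepsilon$, where $\lVert\cdot\rVert$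 is the Euclidean norm; set $\omega_{\min}(\sigma,d_{in},d_{out})=\infty$ if there is no such $\omega$. Then $$d_{in}<\omega_{\min}(\sigma,d_{in},d_{out}).$$ -/

import Mathlib

open scoped ENNReal Matrix

/-- A feedforward network with input dimension `m` and output dimension `n`: finitely many (possibly
zero) hidden layers, each with a weight matrix and a bias, followed by an affine output layer.
The data are weights and biases only; the activation function enters in `NeuralNet.eval`. -/
inductive NeuralNet : ℕ → ℕ → Type
  | output {m n : ℕ} (W : Matrix (Fin n) (Fin m) ℝ) (b : Fin n → ℝ) : NeuralNet m n
  | hidden {m k n : ℕ} (W : Matrix (Fin k) (Fin m) ℝ) (b : Fin k → ℝ) (N : NeuralNet k n) :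
      NeuralNet m n

namespace NeuralNet

/-- The affine map `x ↦ W x + b` between Euclidean spaces. -/
noncomputable def affine {m n : ℕ} (W : Matrix (Fin n) (Fin m) ℝ) (b : Fin n → ℝ)
    (x : EuclideanSpace ℝ (Fin m)) : EuclideanSpace ℝ (Fin n) :=
  WithLp.toLp 2 (W *ᵥ x.ofLp + b)

/-- The scalar function `σ` applied to every coordinate. -/
def applyCoord (σ : ℝ → ℝ) {n : ℕ} (x : EuclideanSpace ℝ (Fin n)) : EuclideanSpace ℝ (Fin n) :=
  WithLp.toLp 2 (fun i => σ (x i))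

/-- The network function `x ↦ W_L (A_{L-1} ∘ ⋯ ∘ A_1) x + b_L` with `A_j x = σ (W_j x + b_j)`. -/
noncomputable def eval (σ : ℝ → ℝ) :
    {m n : ℕ} → NeuralNet m n → EuclideanSpace ℝ (Fin m) → EuclideanSpace ℝ (Fin n)
  | _, _, output W b, x => affine W b x
  | _, _, hidden W b N, x => eval σ N (applyCoord σ (affine W b x))

/-- The width `max {d_1, …, d_L}`: the largest dimension of a layer, the output layer included and
the input not. -/
def width : {m n : ℕ} → NeuralNet m n → ℕ
  | _, n, output _ _ => n
  | _, _, @hidden _ k _ _ _ N => max k (width N)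

end NeuralNet

/-- The rectified linear unit. -/
noncomputable def relu (t : ℝ) : ℝ := max t 0

/-- The cube `[a, b]^d`. -/
def cube (a b : ℝ) (d : ℕ) : Set (EuclideanSpace ℝ (Fin d)) :=
  {x | ∀ i, x i ∈ Set.Icc a b}

/-- The supremum over `D` of the Euclidean norm of `g`, in `[0, ∞]`. -/
noncomputable def supNormOn {m n : ℕ} (D : Set (EuclideanSpace ℝ (Fin m)))
    (g : EuclideanSpace ℝ (Fin m) → EuclideanSpace ℝ (Fin n)) : ℝ≥0∞ :=
  ⨆ x ∈ D, ‖g x‖ₑ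

/-- Networks with activation `σ` and width at most `w` approximate every continuous function
`[a, b]^dIn → ℝ^dOut` uniformly and with arbitrary accuracy. -/
def IsUniversalWidth (σ : ℝ → ℝ) (a b : ℝ) (dIn dOut w : ℕ) : Prop :=
  ∀ f : EuclideanSpace ℝ (Fin dIn) → EuclideanSpace ℝ (Fin dOut),
    ContinuousOn f (cube a b dIn) → ∀ ε : ℝ, 0 < ε →
      ∃ N : NeuralNet dIn dOut, N.width ≤ w ∧
        supNormOn (cube a b dIn) (fun x => f x - N.eval σ x) < ENNReal.ofReal ε

/-- The minimal width for universal approximation on `[a, b]^dIn`; it is `⊤` if no width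
suffices. -/
noncomputable def minWidth (σ : ℝ → ℝ) (a b : ℝ) (dIn dOut : ℕ) : ℕ∞ :=
  sInf {v : ℕ∞ | ∃ w : ℕ, v = w ∧ IsUniversalWidth σ a b dIn dOut w}

open Set Topology Filter

/-! Networks of width at most `dIn` obey a minimum principle: on a bounded open set `U`, no
coordinate has a value at a point of `U` strictly below all its values on `frontier U`. The distance
to the centre of a ball violates this by a fixed margin, so it cannot be approximated. The principle
follows by induction on layers. If the first matrix has a kernel, the network is constant on a line
through the point, and that line meets the frontier. Otherwise the width bound makes the matrix
square and invertible; the layer is then continuous and open, and frontier points of the image of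
`U` come from `frontier U`. ReLU is not open and is reached as a limit. -/

/-- A preconnected set that meets a set and its complement meets the frontier of the set. -/
theorem IsPreconnected.inter_frontier_nonempty_of_inter_of_diff {X : Type*} [TopologicalSpace X]
    {s U : Set X} (hs : IsPreconnected s) (hin : (s ∩ U).Nonempty) (hout : (s \ U).Nonempty) :
    (s ∩ frontier U).Nonempty := by
  by_contra! h
  have hfr : ∀ x ∈ s, x ∉ frontier U := fun x hx hxU => h.subset ⟨hx, hxU⟩
  have h1 : s ∩ U ⊆ interior U := fun x hx => by
    by_contra hxi
    exact hfr x hx.1 ⟨subset_closure hx.2, hxi⟩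
  have h2 : s \ U ⊆ (closure U)ᶜ := fun x hx hxc =>
    hfr x hx.1 ⟨hxc, fun hxi => hx.2 (interior_subset hxi)⟩
  have hcov : s ⊆ interior U ∪ (closure U)ᶜ := fun x hx =>
    (em (x ∈ U)).imp (fun hxU => h1 ⟨hx, hxU⟩) (fun hxU => h2 ⟨hx, hxU⟩)
  obtain ⟨x, -, hx, hx'⟩ := hs _ _ isOpen_interior isClosed_closure.isOpen_compl hcov
    (hin.mono (subset_inter inter_subset_left h1)) (hout.mono (subset_inter sdiff_subset h2))
  exact hx' (subset_closure (interior_subset hx))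

/-- A ray starting in a bounded set meets the frontier of the set. -/
theorem exists_ray_mem_frontier {E : Type*} [NormedAddCommGroup E] [NormedSpace ℝ E]
    {U : Set E} (hU : Bornology.IsBounded U) {p v : E} (hp : p ∈ U) (hv : v ≠ 0) :
    ∃ t : ℝ, 0 ≤ t ∧ p + t • v ∈ frontier U := by
  obtain ⟨R, hR⟩ := hU.subset_closedBall p
  have hv' : 0 < ‖v‖ := norm_pos_iff.2 hv
  have hR0 : 0 ≤ R := by simpa using (hR hp)
  have hcont : Continuous fun t : ℝ => p + t • v := by fun_prop
  have hconn : IsPreconnected ((fun t : ℝ => p + t • v) '' Ici 0) :=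
    isPreconnected_Ici.image _ hcont.continuousOn
  have hin : (((fun t : ℝ => p + t • v) '' Ici 0) ∩ U).Nonempty :=
    ⟨p, ⟨0, self_mem_Ici, by simp⟩, hp⟩
  have hout : (((fun t : ℝ => p + t • v) '' Ici 0) \ U).Nonempty := by
    have ht : 0 ≤ (R + 1) / ‖v‖ := by positivity
    refine ⟨_, ⟨(R + 1) / ‖v‖, ht, rfl⟩, fun h => ?_⟩
    have := hR h
    rw [Metric.mem_closedBall, dist_eq_norm, add_sub_cancel_left, norm_smul, Real.norm_of_nonneg ht,
      div_mul_cancel₀ _ hv'.ne'] at this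
    linarith
  obtain ⟨_, ⟨t, ht, rfl⟩, h⟩ := hconn.inter_frontier_nonempty_of_inter_of_diff hin hout
  exact ⟨t, ht, h⟩

/-- An injective continuous open map sends the frontier of a relatively compact open set
onto a superset of the frontier of the image. -/
theorem frontier_image_subset_image_frontier {X Y : Type*} [TopologicalSpace X]
    [TopologicalSpace Y] [T2Space Y] {A : X → Y} (hA : Continuous A) (hAo : IsOpenMap A)
    {U : Set X} (hU : IsOpen U) (hUc : IsCompact (closure U)) :
    frontier (A '' U) ⊆ A '' frontier U := by
  intro y hy
  have hsub : closure (A '' U) ⊆ A '' closure U :=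
    closure_minimal (image_mono subset_closure) (hUc.image hA).isClosed
  rw [(hAo U hU).frontier_eq] at hy
  obtain ⟨x, hx, rfl⟩ := hsub hy.1
  exact ⟨x, hU.frontier_eq ▸ ⟨hx, fun hxU => hy.2 (mem_image_of_mem A hxU)⟩, rfl⟩

/-- A continuous injective real function is an open map. -/
theorem isOpenMap_of_continuous_strictMono_or_strictAnti {σ : ℝ → ℝ} (hσ : Continuous σ)
    (h : StrictMono σ ∨ StrictAnti σ) : IsOpenMap σ := by
  have key : ∀ {τ : ℝ → ℝ}, Continuous τ → StrictMono τ → IsOpenMap τ := fun {τ} hτ hm => by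
    refine isOpenMap_iff_nhds_le.2 fun x s hs => ?_
    obtain ⟨l, u, hx, hlu⟩ := mem_nhds_iff_exists_Ioo_subset.1 (mem_map.1 hs)
    obtain ⟨l', hl', hl'x⟩ := exists_between hx.1
    obtain ⟨u', hxu', hu'⟩ := exists_between hx.2
    filter_upwards [Ioo_mem_nhds (hm hl'x) (hm hxu')] with y hy
    obtain ⟨z, hz, rfl⟩ := intermediate_value_Icc (hl'x.trans hxu').le hτ.continuousOn
      (Ioo_subset_Icc_self hy)
    exact hlu ⟨hl'.trans_le hz.1, hz.2.trans_lt hu'⟩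
  rcases h with h | h
  · exact key hσ h
  · have := (Homeomorph.neg ℝ).isOpenMap.comp (key hσ.neg h.neg)
    simpa [Function.comp_def] using this

namespace NeuralNet

theorem le_width {m n : ℕ} (N : NeuralNet m n) : n ≤ N.width := by
  induction N with
  | output W b => exact le_rfl
  | hidden W b N ih => exact ih.trans (le_max_right _ _)

theorem continuous_affine {m n : ℕ} (W : Matrix (Fin n) (Fin m) ℝ) (b : Fin n → ℝ) :
    Continuous (affine W b) := by
  unfold affine
  fun_prop

theorem affine_add_smul_of_mulVec_eq_zero {m n : ℕ} {W : Matrix (Fin n) (Fin m) ℝ}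
    {b : Fin n → ℝ} {v : EuclideanSpace ℝ (Fin m)} (hv : W *ᵥ v.ofLp = 0)
    (x : EuclideanSpace ℝ (Fin m)) (t : ℝ) : affine W b (x + t • v) = affine W b x := by
  simp [affine, Matrix.mulVec_add, Matrix.mulVec_smul, hv]

theorem isOpenMap_affine {m n : ℕ} {W : Matrix (Fin n) (Fin m) ℝ} (b : Fin n → ℝ)
    (hW : Function.Surjective W.mulVec) : IsOpenMap (affine W b) := by
  have h1 : IsOpenMap W.mulVecLin :=
    (LinearMap.toContinuousLinearMap W.mulVecLin).isOpenMap hW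
  have h2 := (Homeomorph.addRight b).isOpenMap.comp
    (h1.comp (PiLp.homeomorph 2 (fun _ : Fin m => ℝ)).isOpenMap)
  exact (PiLp.homeomorph 2 (fun _ : Fin n => ℝ)).symm.isOpenMap.comp h2

theorem continuous_applyCoord {σ : ℝ → ℝ} (hσ : Continuous σ) (n : ℕ) :
    Continuous (applyCoord σ (n := n)) := by
  unfold applyCoord
  fun_prop

theorem isOpenMap_applyCoord {σ : ℝ → ℝ} (hσ : IsOpenMap σ) (n : ℕ) :
    IsOpenMap (applyCoord σ (n := n)) := by
  have h : IsOpenMap (Pi.map fun _ : Fin n => σ) :=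
    IsOpenMap.piMap (fun _ => hσ) (by simp)
  exact (PiLp.homeomorph 2 (fun _ : Fin n => ℝ)).symm.isOpenMap.comp
    (h.comp (PiLp.homeomorph 2 (fun _ : Fin n => ℝ)).isOpenMap)

/-- Networks of width at most the input dimension, with continuous open activation function, obey
a minimum principle. -/
theorem exists_frontier_eval_le {σ : ℝ → ℝ} (hσ : Continuous σ) (hσo : IsOpenMap σ) {m n : ℕ}
    (N : NeuralNet m n) (hm : 0 < m) (hN : N.width ≤ m) (i : Fin n)
    {U : Set (EuclideanSpace ℝ (Fin m))} (hU : IsOpen U) (hUb : Bornology.IsBounded U)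
    {p : EuclideanSpace ℝ (Fin m)} (hp : p ∈ U) :
    ∃ q ∈ frontier U, N.eval σ q i ≤ N.eval σ p i := by
  induction N with
  | @output m n W b =>
    -- An affine coordinate is non-increasing along `v` or along `-v`.
    obtain ⟨v, hv, hWv⟩ : ∃ v : EuclideanSpace ℝ (Fin m), v ≠ 0 ∧ (W *ᵥ v.ofLp) i ≤ 0 := by
      have : Nonempty (Fin m) := ⟨⟨0, hm⟩⟩
      obtain ⟨v, hv⟩ := exists_ne (0 : EuclideanSpace ℝ (Fin m))
      rcases le_total ((W *ᵥ v.ofLp) i) 0 with h | h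
      · exact ⟨v, hv, h⟩
      · exact ⟨-v, neg_ne_zero.2 hv, by simpa [Matrix.mulVec_neg] using h⟩
    obtain ⟨t, ht, hq⟩ := exists_ray_mem_frontier hUb hp hv
    refine ⟨_, hq, ?_⟩
    have := mul_nonpos_of_nonneg_of_nonpos ht hWv
    simpa [eval, affine, Matrix.mulVec_add, Matrix.mulVec_smul] using this
  | @hidden m k n W b N ih =>
    have hkm : k ≤ m := (le_max_left _ _).trans hN
    by_cases hW : Function.Injective W.mulVec
    · obtain rfl : k = m := by
        refine le_antisymm hkm ?_
        have := LinearMap.finrank_le_finrank_of_injective (f := W.mulVecLin) hW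
        simpa using this
      have hWs : Function.Surjective W.mulVec :=
        (LinearMap.injective_iff_surjective (f := W.mulVecLin)).1 hW
      have hA : Continuous fun x => applyCoord σ (affine W b x) :=
        (continuous_applyCoord hσ k).comp (continuous_affine W b)
      have hAo : IsOpenMap fun x => applyCoord σ (affine W b x) :=
        (isOpenMap_applyCoord hσo k).comp (isOpenMap_affine b hWs)
      have hUc : IsCompact (closure U) := hUb.isCompact_closure
      -- The remaining layers obey the principle on the image of `U`, which is again open and
      -- bounded.
      obtain ⟨q', hq', hle⟩ := ih hm ((le_max_right _ _).trans hN) i (hAo U hU)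
        ((hUc.image hA).isBounded.subset (image_mono subset_closure)) (mem_image_of_mem _ hp)
      obtain ⟨q, hq, rfl⟩ := frontier_image_subset_image_frontier hA hAo hU hUc hq'
      exact ⟨q, hq, hle⟩
    · obtain ⟨v, hWv, hv⟩ : ∃ v : Fin m → ℝ, W *ᵥ v = 0 ∧ v ≠ 0 := by
        by_contra! h
        exact hW ((injective_iff_map_eq_zero W.mulVecLin).2 h)
      obtain ⟨t, -, hq⟩ := exists_ray_mem_frontier hUb hp
        (v := WithLp.toLp 2 v) (by simpa using hv)
      refine ⟨_, hq, ?_⟩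
      simp only [eval]
      rw [affine_add_smul_of_mulVec_eq_zero hWv]

/-- The value of a network depends jointly continuously on the input and on a parameter of the
activation function. -/
theorem continuous_eval_param {T : Type*} [TopologicalSpace T] {σ : T → ℝ → ℝ}
    (hσ : Continuous fun z : T × ℝ => σ z.1 z.2) {m n : ℕ} (N : NeuralNet m n) :
    Continuous fun z : T × EuclideanSpace ℝ (Fin m) => N.eval (σ z.1) z.2 := by
  induction N with
  | output W b => exact (continuous_affine W b).comp continuous_snd
  | @hidden m k n W b N ih =>
    have hc : Continuous fun z : T × EuclideanSpace ℝ (Fin m) =>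
        applyCoord (σ z.1) (affine W b z.2) := by
      have haff := (continuous_affine W b).comp (continuous_snd (X := T))
      refine (PiLp.continuous_toLp 2 _).comp (continuous_pi fun i => ?_)
      have hi : Continuous fun z : T × EuclideanSpace ℝ (Fin m) => affine W b z.2 i :=
        (PiLp.continuous_apply 2 _ i).comp haff
      exact hσ.comp (continuous_fst.prodMk hi)
    exact ih.comp (continuous_fst.prodMk hc)

/-- The minimum principle for the rectified linear unit, as a limit of strictly increasing activation
functions. -/
theorem exists_frontier_eval_le_relu {m n : ℕ}
    (N : NeuralNet m n) (hm : 0 < m) (hN : N.width ≤ m) (i : Fin n)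
    {U : Set (EuclideanSpace ℝ (Fin m))} (hU : IsOpen U) (hUb : Bornology.IsBounded U)
    {p : EuclideanSpace ℝ (Fin m)} (hp : p ∈ U) :
    ∃ q ∈ frontier U, N.eval relu q i ≤ N.eval relu p i := by
  -- For `0 < δ < 1` this is the leaky ReLU; at `δ = 0` it is `relu`.
  let τ : ℝ → ℝ → ℝ := fun δ t => max t (δ * t)
  have hτ : Continuous fun z : ℝ × ℝ => τ z.1 z.2 := by fun_prop
  have hτ0 : τ 0 = relu := by funext t; simp [τ, relu]
  have hmono : ∀ δ : ℝ, 0 < δ → StrictMono (τ δ) := fun δ hδ =>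
    fun _ _ h => max_lt_max h (mul_lt_mul_of_pos_left h hδ)
  have hg : Continuous fun z : ℝ × EuclideanSpace ℝ (Fin m) => N.eval (τ z.1) z.2 i :=
    (PiLp.continuous_apply 2 _ i).comp (continuous_eval_param hτ N)
  have hgp : Continuous fun z : ℝ × EuclideanSpace ℝ (Fin m) => N.eval (τ z.1) p i :=
    hg.comp (continuous_fst.prodMk continuous_const)
  have hK : IsCompact (frontier U) :=
    hUb.isCompact_closure.of_isClosed_subset isClosed_frontier frontier_subset_closure
  let u : ℕ → ℝ := fun j => 1 / ((j : ℝ) + 1)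
  have hu : Tendsto u atTop (𝓝 0) := tendsto_one_div_add_atTop_nhds_zero_nat
  have hex : ∀ j, ∃ q ∈ frontier U, N.eval (τ (u j)) q i ≤ N.eval (τ (u j)) p i := fun j => by
    have hc : Continuous (τ (u j)) := hτ.comp (continuous_const.prodMk continuous_id)
    exact exists_frontier_eval_le hc (isOpenMap_of_continuous_strictMono_or_strictAnti hc
      (Or.inl (hmono _ (by positivity)))) N hm hN i hU hUb hp
  choose q hq hle using hex
  -- The frontier points vary with the parameter, so the limit needs compactness and joint
  -- continuity.
  obtain ⟨q₀, hq₀, φ, hφ, hlim⟩ := hK.tendsto_subseq hq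
  have hpair : Tendsto (fun j => (u (φ j), q (φ j))) atTop (𝓝 (0, q₀)) :=
    (hu.comp hφ.tendsto_atTop).prodMk_nhds hlim
  have := le_of_tendsto_of_tendsto' ((hg.tendsto _).comp hpair) ((hgp.tendsto _).comp hpair)
    fun j => hle (φ j)
  exact ⟨q₀, hq₀, by simpa [hτ0] using this⟩

end NeuralNet

theorem norm_lt_of_supNormOn_lt {m n : ℕ} {D : Set (EuclideanSpace ℝ (Fin m))}
    {g : EuclideanSpace ℝ (Fin m) → EuclideanSpace ℝ (Fin n)} {ε : ℝ}
    (h : supNormOn D g < ENNReal.ofReal ε) {x : EuclideanSpace ℝ (Fin m)} (hx : x ∈ D) :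
    ‖g x‖ < ε := by
  have h1 : ‖g x‖ₑ < ENNReal.ofReal ε :=
    (le_iSup₂ (f := fun x (_ : x ∈ D) => ‖g x‖ₑ) x hx).trans_lt h
  rw [← ofReal_norm] at h1
  exact (ENNReal.ofReal_lt_ofReal_iff'.1 h1).1

theorem closedBall_subset_cube (a b : ℝ) (d : ℕ) :
    Metric.closedBall (WithLp.toLp 2 fun _ : Fin d => (a + b) / 2) ((b - a) / 2) ⊆ cube a b d := by
  intro x hx i
  have h1 := (PiLp.norm_apply_le (x - WithLp.toLp 2 fun _ : Fin d => (a + b) / 2) i).trans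
    (mem_closedBall_iff_norm.1 hx)
  have h2 := abs_le.1 (by simpa using h1 : |x i - (a + b) / 2| ≤ (b - a) / 2)
  exact ⟨by linarith [h2.1], by linarith [h2.2]⟩

/-- With `f` the distance to `c`, an error below `r / 2` would put the network below `r / 2` at `c`
and above `r / 2` on the sphere of radius `r`, against the minimum principle. -/
theorem not_isUniversalWidth_of_le {σ : ℝ → ℝ}
    (hσ : (Continuous σ ∧ (StrictMono σ ∨ StrictAnti σ)) ∨ σ = relu)
    {a b : ℝ} (hab : a < b) {dIn dOut : ℕ} (hOut : 1 ≤ dOut) {w : ℕ} (hw : w ≤ dIn) :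
    ¬ IsUniversalWidth σ a b dIn dOut w := by
  intro huniv
  let c : EuclideanSpace ℝ (Fin dIn) := WithLp.toLp 2 fun _ => (a + b) / 2
  let r : ℝ := (b - a) / 2
  have hr : 0 < r := half_pos (sub_pos.2 hab)
  let i : Fin dOut := ⟨0, hOut⟩
  let f : EuclideanSpace ℝ (Fin dIn) → EuclideanSpace ℝ (Fin dOut) :=
    fun x => WithLp.toLp 2 fun _ => ‖x - c‖
  have hf : Continuous f := by fun_prop
  obtain ⟨N, hNw, hN⟩ := huniv f hf.continuousOn (r / 2) (half_pos hr)
  have hNd : N.width ≤ dIn := hNw.trans hw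
  -- The width counts the output layer, which rules out `dIn = 0`.
  have hd : 0 < dIn := hOut.trans (N.le_width.trans hNd)
  obtain ⟨q, hq, hle⟩ : ∃ q ∈ frontier (Metric.ball c r), N.eval σ q i ≤ N.eval σ c i := by
    rcases hσ with ⟨hc, hmono⟩ | rfl
    · exact N.exists_frontier_eval_le hc
        (isOpenMap_of_continuous_strictMono_or_strictAnti hc hmono) hd hNd i Metric.isOpen_ball
        Metric.isBounded_ball (Metric.mem_ball_self hr)
    · exact N.exists_frontier_eval_le_relu hd hNd i Metric.isOpen_ball
        Metric.isBounded_ball (Metric.mem_ball_self hr)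
  have hqr : ‖q - c‖ = r := mem_sphere_iff_norm.1 (Metric.frontier_ball_subset_sphere hq)
  have happrox : ∀ x, ‖x - c‖ ≤ r → |‖x - c‖ - N.eval σ x i| < r / 2 := fun x hx =>
    (PiLp.norm_apply_le (f x - N.eval σ x) i).trans_lt
      (norm_lt_of_supNormOn_lt hN (closedBall_subset_cube a b dIn (mem_closedBall_iff_norm.2 hx)))
  have h1 := (abs_lt.1 (happrox q hqr.le)).2
  have h2 := (abs_lt.1 (happrox c (by simpa using hr.le))).1
  rw [hqr] at h1
  simp only [sub_self, norm_zero] at h2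
  linarith

theorem mainTheorem2 (σ : ℝ → ℝ)
    (hσ : (Continuous σ ∧ (StrictMono σ ∨ StrictAnti σ)) ∨ σ = relu)
    (a b : ℝ) (hab : a < b) (dIn dOut : ℕ) (hOut : 1 ≤ dOut) :
    (dIn : ℕ∞) < minWidth σ a b dIn dOut := by
  -- A non-strict bound by `dIn + 1` passes to the infimum, also when it is `⊤`.
  refine lt_of_lt_of_le (b := ((dIn + 1 : ℕ) : ℕ∞)) (by exact_mod_cast Nat.lt_succ_self dIn) ?_
  refine le_sInf ?_
  rintro _ ⟨w, rfl, hw⟩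
  by_contra! h
  exact not_isUniversalWidth_of_le hσ hab hOut
    (Nat.lt_succ_iff.1 (by exact_mod_cast h)) hw
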